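/- Let $d\ge 1$. For $v>0$, a set $\mathcal U\subset\mathbb R^d$ is a $v$-universal convex covering of $\mathbb R^d$ if $\mathcal C+\mathcal U=\mathbb R^d$ for every convex set $\mathcal C\subset\mathbb R^d$ of Lebesgue measure strictly greater than $v$, and it is a universal convex covering of $\mathbb R^d$ if this holds for some $v>0$. For $\mathcal S\subset\mathbb R^d$ and $r\ge 0$ let $f_{\mathcal S}(r)\in\{0,1,2,\dots,\infty\}$ be the number of points of $\mathcal S$ at Euclidean distance at most $r$ from the origin. (i) For every universal convex covering $\mathcal U$ of $\mathbb R^d$ there exist $t>0$ and $w\in\mathbb R^d$ such that $f_{t\,\mathcal U+w}(r)\ge r^d$ for every $r\ge 0$. (ii) There exist a universal convex covering $\mathcal U_d$ of $\mathbb R^d$ and a real number $r_0$ such that $f_{\mathcal U_d}(r)\le (\log r)^{d-1}\,r^d$ for every $r\ge r_0$. -/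

import Mathlib

open scoped Pointwise

/-- `U` is a `v`-universal convex covering of `ℝ^d`: the Minkowski sum `C + U` is the whole space
for every convex set `C` of volume strictly greater than `v` (possibly infinite). -/
def IsVUniversalConvexCovering {d : ℕ} (v : ℝ) (U : Set (EuclideanSpace ℝ (Fin d))) : Prop :=
  ∀ C : Set (EuclideanSpace ℝ (Fin d)), Convex ℝ C →
    ENNReal.ofReal v < MeasureTheory.volume C → C + U = Set.univ

/-- `U` is a universal convex covering of `ℝ^d` if it is a `v`-universal one for some `v > 0`. -/
def IsUniversalConvexCovering {d : ℕ} (U : Set (EuclideanSpace ℝ (Fin d))) : Prop :=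
  ∃ v : ℝ, 0 < v ∧ IsVUniversalConvexCovering v U

/-- The number (possibly infinite) of points of `S` at Euclidean distance at most `r` from the
origin. -/
noncomputable def growthCount {d : ℕ} (S : Set (EuclideanSpace ℝ (Fin d))) (r : ℝ) : ℕ∞ :=
  (S ∩ Metric.closedBall 0 r).encard

/-! `U` is a covering iff it meets every convex set of volume above `v`. For (i), disjoint equal
cubes of volume above `v` each contain a point of `U`; packing them at one point of `U` yields at
least `r ^ d` points after rescaling. For (ii), `U` is the union of all grids `∏ 2 ^ e i ℤ` of fixed
covolume `2 ^ k`, with points on coordinate hyperplanes removed. It is a covering by induction on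
the dimension (`exists_dyadic_point`): some slice has volume times the length of the projection at
least that of the set; halving towards the far side of the projection costs a constant factor, and
lets the slice sit at a nonzero multiple of a power of two comparable to that length. For the count,
a nonzero coordinate of size at most `r` forces `2 ^ e i ≤ r`; as the exponents sum to `k ≥ 0`, only
`O((log r) ^ (d - 1))` grids matter, each with at most `(2 * r) ^ d / 2 ^ k` points. A large `k`
absorbs the constants. -/

/-! ### Dyadic points in convex sets of large volume -/

/-- The union of all dyadic grids `∏ 2 ^ e i ℤ` with `∑ e i = k`, without the coordinate
hyperplanes. -/
def dyadicGrids (n : ℕ) (k : ℤ) : Set (Fin n → ℝ) :=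
  {x | ∃ e m : Fin n → ℤ, ∑ i, e i = k ∧ ∀ i, m i ≠ 0 ∧ x i = 2 ^ e i * m i}

/-- Two consecutive multiples of `h` fit in the interval, and one of them is nonzero. -/
lemma exists_ne_zero_mul_mem_Ioo {p q h : ℝ} (hh : 0 < h) (hpq : 2 * h < q - p) :
    ∃ m : ℤ, m ≠ 0 ∧ h * m ∈ Set.Ioo p q := by
  have h1 : p / h < ⌊p / h⌋ + 1 := Int.lt_floor_add_one _
  have h2 : (⌊p / h⌋ : ℝ) ≤ p / h := Int.floor_le _
  rw [div_lt_iff₀ hh] at h1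
  rw [le_div_iff₀ hh] at h2
  by_cases h0 : ⌊p / h⌋ + 1 = 0
  · refine ⟨⌊p / h⌋ + 2, by omega, ?_, ?_⟩ <;> push_cast <;> nlinarith
  · refine ⟨⌊p / h⌋ + 1, h0, ?_, ?_⟩ <;> push_cast <;> nlinarith

/-- The slice of a set in `ℝ^(n+1)` at first coordinate `t`. -/
def firstSlice {n : ℕ} (C : Set (Fin (n + 1) → ℝ)) (t : ℝ) : Set (Fin n → ℝ) :=
  {y | (Fin.cons t y : Fin (n + 1) → ℝ) ∈ C}

lemma IsOpen.firstSlice {n : ℕ} {C : Set (Fin (n + 1) → ℝ)} (hC : IsOpen C) (t : ℝ) :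
    IsOpen (firstSlice C t) :=
  hC.preimage (by fun_prop : Continuous fun y : Fin n → ℝ => (Fin.cons t y : Fin (n + 1) → ℝ))

lemma Fin.cons_combo {n : ℕ} (a b s t : ℝ) (y z : Fin n → ℝ) :
    a • (Fin.cons s y : Fin (n + 1) → ℝ) + b • (Fin.cons t z : Fin (n + 1) → ℝ) =
      Fin.cons (a * s + b * t) (a • y + b • z) := by
  ext i
  refine Fin.cases ?_ (fun j => ?_) i <;> simp

lemma Convex.firstSlice {n : ℕ} {C : Set (Fin (n + 1) → ℝ)} (hC : Convex ℝ C) (t : ℝ) :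
    Convex ℝ (firstSlice C t) := by
  intro y hy z hz a b ha hb hab
  have h := hC hy hz ha hb hab
  rw [Fin.cons_combo, ← add_mul, hab, one_mul] at h
  exact h

lemma volume_eq_lintegral_firstSlice {n : ℕ} {C : Set (Fin (n + 1) → ℝ)} (hC : IsOpen C) :
    MeasureTheory.volume C = ∫⁻ t, MeasureTheory.volume (firstSlice C t) := by
  have h := (MeasureTheory.volume_preserving_piFinSuccAbove (fun _ : Fin (n + 1) => ℝ) 0).symm
  rw [← h.measure_preimage hC.measurableSet.nullMeasurableSet]
  have hm := h.measurable hC.measurableSet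
  rw [MeasureTheory.Measure.volume_eq_prod, MeasureTheory.Measure.prod_apply hm]
  refine MeasureTheory.lintegral_congr fun t => ?_
  congr 1
  ext y
  simp [firstSlice, MeasurableEquiv.piFinSuccAbove]
  rfl

/-- By convexity, the midpoints between the slice at `t` and one point over `y` form a translated
half-scale copy of that slice. -/
lemma firstSlice_midpoint_volume_ge {n : ℕ} {C : Set (Fin (n + 1) → ℝ)} (hC : Convex ℝ C)
    (t : ℝ) {y : ℝ} (hy : (firstSlice C y).Nonempty) :
    ENNReal.ofReal ((1 / 2) ^ n) * MeasureTheory.volume (firstSlice C t) ≤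
      MeasureTheory.volume (firstSlice C ((t + y) / 2)) := by
  obtain ⟨z, hz⟩ := hy
  have h1 : (fun h => -((1 / 2 : ℝ) • z) + h) ⁻¹' ((1 / 2 : ℝ) • firstSlice C t) ⊆
      firstSlice C ((t + y) / 2) := by
    rintro h ⟨w, hw, hwh⟩
    have h2 := hC hw hz (show (0 : ℝ) ≤ 1 / 2 by norm_num) (show (0 : ℝ) ≤ 1 / 2 by norm_num)
      (by norm_num)
    rw [Fin.cons_combo] at h2
    simp only at hwh
    rw [hwh] at h2
    have h3 : (1 / 2 * t + 1 / 2 * y : ℝ) = (t + y) / 2 := by ring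
    rw [h3, neg_add_eq_sub, sub_add_cancel] at h2
    exact h2
  refine le_trans (le_of_eq ?_) (MeasureTheory.measure_mono h1)
  rw [MeasureTheory.measure_preimage_add, MeasureTheory.Measure.addHaar_smul]
  simp

/-- Otherwise every slice over the projection has volume at most `V` divided by its length, and
Fubini bounds the total by `V`. -/
lemma exists_mul_volume_firstSlice_gt {n : ℕ} {C : Set (Fin (n + 1) → ℝ)} (hC : IsOpen C)
    {V : ENNReal} (h0 : V ≠ 0) (hV : V < MeasureTheory.volume C) :
    ∃ t, V < MeasureTheory.volume (firstSlice C t) *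
      MeasureTheory.volume {s | (firstSlice C s).Nonempty} := by
  by_contra! h
  set I := {s | (firstSlice C s).Nonempty}
  refine hV.not_ge ?_
  rw [volume_eq_lintegral_firstSlice hC]
  calc ∫⁻ t, MeasureTheory.volume (firstSlice C t)
      ≤ ∫⁻ t, I.indicator (fun _ => V / MeasureTheory.volume I) t := by
        refine MeasureTheory.lintegral_mono fun t => ?_
        by_cases ht : t ∈ I
        · rw [Set.indicator_of_mem ht,
            ENNReal.le_div_iff_mul_le (Or.inr h0) (Or.inr hV.ne_top)]
          exact h t
        · have : firstSlice C t = ∅ := Set.not_nonempty_iff_eq_empty.1 ht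
          simp [this]
    _ ≤ V / MeasureTheory.volume I * MeasureTheory.volume I :=
        MeasureTheory.lintegral_indicator_const_le _ _
    _ ≤ V := (ENNReal.le_div_iff_mul_le (Or.inr h0) (Or.inr hV.ne_top)).1 le_rfl

lemma exists_sub_gt_of_volume_gt {I : Set ℝ} {l : ℝ}
    (h : ENNReal.ofReal l < MeasureTheory.volume I) : ∃ a ∈ I, ∃ b ∈ I, l < b - a := by
  by_contra! hI
  refine h.not_ge ((Real.volume_le_diam I).trans (Metric.ediam_le fun a ha b hb => ?_))
  rw [edist_dist]
  refine ENNReal.ofReal_le_ofReal ?_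
  rw [Real.dist_eq, abs_le]
  exact ⟨by linarith [hI a ha b hb], hI b hb a ha⟩

/-- Sufficiently large open convex sets contain a point with nonzero coordinates in dyadic grids
whose covolume is as large as the volume, up to a constant. -/
lemma exists_dyadic_point (n : ℕ) : ∃ v : ℝ, 0 < v ∧ ∀ C : Set (Fin n → ℝ), IsOpen C →
    Convex ℝ C → ∀ k : ℤ, ENNReal.ofReal (v * 2 ^ k) < MeasureTheory.volume C →
    ∃ x ∈ C, ∃ e m : Fin n → ℤ, k ≤ ∑ i, e i ∧ ∀ i, m i ≠ 0 ∧ x i = 2 ^ e i * m i := by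
  induction n with
  | zero =>
    refine ⟨1, one_pos, fun C _ _ k hk => ?_⟩
    obtain ⟨x, hx⟩ : C.Nonempty := by
      by_contra h
      simp [Set.not_nonempty_iff_eq_empty.1 h] at hk
    refine ⟨x, hx, 0, 0, ?_, fun i => i.elim0⟩
    have h1 : MeasureTheory.volume C ≤ ENNReal.ofReal 1 := by
      rw [MeasureTheory.volume_pi, MeasureTheory.Measure.pi_of_empty, ENNReal.ofReal_one]
      exact MeasureTheory.prob_le_one
    have h2 := hk.trans_le h1
    rw [ENNReal.ofReal_lt_ofReal_iff one_pos, one_mul] at h2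
    by_contra! h3
    simp only [Pi.zero_apply, Finset.sum_const_zero] at h3
    exact h2.not_ge (one_le_zpow₀ (by norm_num) h3.le)
  | succ n ih =>
    obtain ⟨v, hv, ih⟩ := ih
    -- The 8 comes from `l < 8 * 2 ^ e` below, the `2 ^ n` from halving a slice of dimension `n`.
    refine ⟨8 * 2 ^ n * v, by positivity, fun C hCo hC k hk => ?_⟩
    set V := 8 * 2 ^ n * v * (2 : ℝ) ^ k with hVdef
    have hV : 0 < V := by positivity
    obtain ⟨t, ht⟩ := exists_mul_volume_firstSlice_gt hCo
      (ENNReal.ofReal_pos.2 hV).ne' hk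
    set I := {s | (firstSlice C s).Nonempty} with hI
    set f := MeasureTheory.volume (firstSlice C t)
    have hf : f ≠ 0 := by
      rintro h
      simp [h] at ht
    rw [mul_comm, ← ENNReal.div_lt_iff (Or.inl hf) (Or.inr ENNReal.ofReal_ne_top)] at ht
    obtain ⟨l, hl1, hl2⟩ := ENNReal.lt_iff_exists_nnreal_btwn.1 ht
    have hl0 : 0 < (l : ℝ) := by
      have : (0 : ENNReal) < l := (zero_le).trans_lt hl1
      exact_mod_cast this
    rw [ENNReal.div_lt_iff (Or.inl hf) (Or.inr ENNReal.ofReal_ne_top)] at hl1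
    obtain ⟨e, he1, he2⟩ := exists_mem_Ico_zpow (div_pos hl0 (show (0 : ℝ) < 4 by norm_num))
      (one_lt_two)
    rw [le_div_iff₀ (by norm_num)] at he1
    rw [div_lt_iff₀ (by norm_num), zpow_add_one₀ (by norm_num)] at he2
    have hpos : (0 : ℝ) < 2 ^ e := by positivity
    have hlI : ENNReal.ofReal (2 ^ e * 4) < MeasureTheory.volume I := by
      refine lt_of_le_of_lt ?_ hl2
      rw [← ENNReal.ofReal_coe_nnreal]
      exact ENNReal.ofReal_le_ofReal he1
    obtain ⟨a, ha, b, hb, hab⟩ := exists_sub_gt_of_volume_gt hlI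
    -- Midpoints of `t` with `[a, b]` fill an interval longer than `2 * 2 ^ e`, which is why `e` was
    -- chosen with `2 ^ e ≤ l / 4`.
    obtain ⟨m, hm0, hm1, hm2⟩ := exists_ne_zero_mul_mem_Ioo (p := (t + a) / 2) (q := (t + b) / 2)
      hpos (by linarith)
    have hIc : Convex ℝ I := by
      rintro s ⟨y, hy⟩ s' ⟨z, hz⟩ a b ha hb hab
      have h := hC hy hz ha hb hab
      rw [Fin.cons_combo] at h
      exact ⟨_, h⟩
    -- The reflection of `t` in `2 ^ e * m`, so that the midpoint is the chosen multiple.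
    have hy : 2 * (2 ^ e * (m : ℝ)) - t ∈ I :=
      hIc.ordConnected.out ha hb ⟨by linarith, by linarith⟩
    have hmid := firstSlice_midpoint_volume_ge hC t hy
    rw [show (t + (2 * (2 ^ e * (m : ℝ)) - t)) / 2 = 2 ^ e * m by ring] at hmid
    have hlt : ENNReal.ofReal (v * 2 ^ (k - e)) < ENNReal.ofReal ((1 / 2) ^ n) * f := by
      rw [← ENNReal.ofReal_coe_nnreal] at hl1
      have h1 : ENNReal.ofReal V < ENNReal.ofReal (2 ^ e * 8) * f :=
        hl1.trans_le (by gcongr; linarith)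
      have h2 : ENNReal.ofReal V =
          ENNReal.ofReal (2 ^ e * 8 * 2 ^ n) * ENNReal.ofReal (v * 2 ^ (k - e)) := by
        rw [← ENNReal.ofReal_mul (by positivity), hVdef, zpow_sub₀ (by norm_num)]
        congr 1
        field_simp
      have h3 : ENNReal.ofReal (2 ^ e * 8) * f =
          ENNReal.ofReal (2 ^ e * 8 * 2 ^ n) * (ENNReal.ofReal ((1 / 2) ^ n) * f) := by
        rw [← mul_assoc, ← ENNReal.ofReal_mul (by positivity)]
        congr 2
        rw [mul_assoc, ← mul_pow]
        norm_num
      rw [h2, h3] at h1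
      exact lt_of_mul_lt_mul_left' h1
    obtain ⟨x, hx, e', m', hk', hem⟩ := ih _ (hCo.firstSlice _) (hC.firstSlice _) (k - e)
      (hlt.trans_le hmid)
    refine ⟨Fin.cons (2 ^ e * (m : ℝ)) x, hx, Fin.cons e e', Fin.cons m m', ?_, fun i => ?_⟩
    · rw [Fin.sum_cons]
      linarith
    · refine Fin.cases ⟨hm0, by simp⟩ (fun j => ?_) i
      simpa using hem j

/-- An exponent sum exceeding `k` by `s` is corrected by refining the first coordinate's grid by `2
^ s`. -/
lemma exists_dyadicGrids_inter_nonempty (n : ℕ) : ∃ v : ℝ, 0 < v ∧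
    ∀ C : Set (Fin (n + 1) → ℝ), IsOpen C → Convex ℝ C → ∀ k : ℤ,
      ENNReal.ofReal (v * 2 ^ k) < MeasureTheory.volume C →
      (C ∩ dyadicGrids (n + 1) k).Nonempty := by
  obtain ⟨v, hv, h⟩ := exists_dyadic_point (n + 1)
  refine ⟨v, hv, fun C hCo hC k hk => ?_⟩
  obtain ⟨x, hx, e, m, hke, hem⟩ := h C hCo hC k hk
  obtain ⟨s, hs⟩ := Int.le.dest hke
  rw [Fin.sum_univ_succ] at hs
  refine ⟨x, hx, Fin.cons (e 0 - s) (Fin.tail e), Fin.cons (2 ^ s * m 0) (Fin.tail m), ?_,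
    fun i => ?_⟩
  · simp only [Fin.sum_cons, Fin.tail]
    linarith
  · refine Fin.cases ⟨?_, ?_⟩ (fun j => ?_) i
    · simpa using (hem 0).1
    · rw [(hem 0).2]
      simp only [Fin.cons_zero]
      push_cast
      rw [zpow_sub₀ (by norm_num), zpow_natCast]
      field_simp
    · simpa [Fin.tail] using hem j.succ

/-! ### Coverings as hitting sets, and the lower bound -/

/-- A point `x` lies in `C + U` iff `x - C` meets `U`, and `x - C` is convex of the same volume. -/
lemma isVUniversalConvexCovering_iff {d : ℕ} {v : ℝ} {U : Set (EuclideanSpace ℝ (Fin d))} :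
    IsVUniversalConvexCovering v U ↔ ∀ C : Set (EuclideanSpace ℝ (Fin d)), Convex ℝ C →
      ENNReal.ofReal v < MeasureTheory.volume C → (C ∩ U).Nonempty := by
  constructor
  · intro h C hC hv
    have h1 := h (-C) hC.neg (by rwa [MeasureTheory.Measure.measure_neg])
    obtain ⟨c, hc, u, hu, hcu⟩ : (0 : EuclideanSpace ℝ (Fin d)) ∈ -C + U := h1 ▸ Set.mem_univ _
    refine ⟨u, ?_, hu⟩
    rw [eq_neg_of_add_eq_zero_right hcu]
    exact hc
  · intro h C hC hv
    refine Set.eq_univ_of_forall fun x => ?_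
    obtain ⟨u, hu, huU⟩ := h (x +ᵥ -C) (hC.neg.vadd x)
      (by rwa [MeasureTheory.measure_vadd, MeasureTheory.Measure.measure_neg])
    obtain ⟨c, hc, rfl⟩ := hu
    exact ⟨-c, hc, x +ᵥ c, huU, by simp⟩

/-- The half-open cube of side `s` with lowest vertex `u + s k`. -/
def gridCube {d : ℕ} (u : EuclideanSpace ℝ (Fin d)) (s : ℝ) (k : Fin d → ℕ) :
    Set (EuclideanSpace ℝ (Fin d)) :=
  WithLp.ofLp ⁻¹' Set.univ.pi fun i => Set.Ico (u i + s * k i) (u i + s * k i + s)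

lemma convex_gridCube {d : ℕ} (u : EuclideanSpace ℝ (Fin d)) (s : ℝ) (k : Fin d → ℕ) :
    Convex ℝ (gridCube u s k) :=
  (convex_pi fun _ _ => convex_Ico _ _).linear_preimage
    (WithLp.linearEquiv 2 ℝ (Fin d → ℝ)).toLinearMap

lemma volume_gridCube {d : ℕ} (u : EuclideanSpace ℝ (Fin d)) {s : ℝ} (hs : 0 ≤ s)
    (k : Fin d → ℕ) : MeasureTheory.volume (gridCube u s k) = ENNReal.ofReal (s ^ d) := by
  rw [gridCube, (PiLp.volume_preserving_ofLp (Fin d)).measure_preimage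
    (MeasurableSet.univ_pi fun i => measurableSet_Ico).nullMeasurableSet, Real.volume_pi_Ico]
  simp [ENNReal.ofReal_pow hs]

lemma eq_of_mem_gridCube {d : ℕ} {u x : EuclideanSpace ℝ (Fin d)} {s : ℝ} (hs : 0 < s)
    {k l : Fin d → ℕ} (hk : x ∈ gridCube u s k) (hl : x ∈ gridCube u s l) : k = l := by
  ext i
  have h1 := hk i trivial
  have h2 := hl i trivial
  have h3 : (k i : ℝ) < l i + 1 := by
    by_contra! h
    nlinarith [h1.1, h2.2]
  have h4 : (l i : ℝ) < k i + 1 := by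
    by_contra! h
    nlinarith [h2.1, h1.2]
  norm_cast at h3 h4
  omega

lemma norm_sub_le_of_mem_gridCube {d N : ℕ} {u x : EuclideanSpace ℝ (Fin d)} {s : ℝ} (hs : 0 < s)
    {k : Fin d → ℕ} (hk : x ∈ gridCube u s k) (hN : ∀ i, k i < N) :
    ‖x - u‖ ≤ √d * (s * N) := by
  have h0 : 0 ≤ s * N := by positivity
  rw [EuclideanSpace.norm_eq, ← Real.sqrt_sq h0, ← Real.sqrt_mul (by positivity)]
  refine Real.sqrt_le_sqrt ?_
  have : ∀ i ∈ Finset.univ, ‖(x - u) i‖ ^ 2 ≤ (s * N) ^ 2 := fun i _ => by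
    have h1 := hk i trivial
    have h2 : (k i : ℝ) + 1 ≤ N := by exact_mod_cast hN i
    have h3 : 0 ≤ s * k i := by positivity
    rw [Real.norm_eq_abs, sq_abs]
    refine pow_le_pow_left₀ ?_ ?_ 2
    · simpa using by linarith [h1.1]
    · simp only [PiLp.sub_apply]
      nlinarith [h1.2]
  simpa using Finset.sum_le_sum this

lemma IsUniversalConvexCovering.exists_growthCount_ge {d : ℕ} (hd : 1 ≤ d)
    {U : Set (EuclideanSpace ℝ (Fin d))} (hU : IsUniversalConvexCovering U) :
    ∃ (t : ℝ) (w : EuclideanSpace ℝ (Fin d)), 0 < t ∧ ∀ r : ℝ, 0 ≤ r →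
      ENNReal.ofReal (r ^ d) ≤ (growthCount ((fun x => t • x + w) '' U) r : ENNReal) := by
  obtain ⟨v, hv, hU⟩ := hU
  rw [isVUniversalConvexCovering_iff] at hU
  set s := v + 1
  have hs : 0 < s := by positivity
  have hsv : v < s ^ d := (lt_add_one v).trans_le
    (le_self_pow₀ (by linarith) (by omega))
  have hmeet : ∀ u k, (gridCube u s k ∩ U).Nonempty := fun u k =>
    hU _ (convex_gridCube u s k) (by
      rw [volume_gridCube u hs.le]
      exact (ENNReal.ofReal_lt_ofReal_iff (hv.trans hsv)).2 hsv)
  -- Moving this point of `U` to the origin handles all `r < 1`.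
  obtain ⟨u, -, hu⟩ := hmeet 0 0
  have hd0 : 0 < √(d : ℝ) := Real.sqrt_pos.2 (by exact_mod_cast hd)
  -- For `r ≥ 1`, the `⌈r⌉₊ ^ d` cubes at `u` lie within `√d * s * ⌈r⌉₊ ≤ 2 * s * √d * r` of `u`.
  set t := 1 / (2 * s * √d)
  have ht : 0 < t := by positivity
  refine ⟨t, -(t • u), ht, fun r hr => ?_⟩
  choose g hgk hgU using hmeet u
  rcases lt_or_ge r 1 with hr1 | hr1
  · calc ENNReal.ofReal (r ^ d) ≤ ((1 : ℕ∞) : ENNReal) := by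
          simpa using pow_le_one₀ hr hr1.le
      _ ≤ _ := ENat.toENNReal_le.2 <| by
          rw [growthCount, Set.one_le_encard_iff_nonempty]
          exact ⟨0, ⟨u, hu, by simp⟩, by simpa using hr⟩
  · set N := ⌈r⌉₊
    have hN : (N : ℝ) ≤ 2 * r := by linarith [Nat.ceil_lt_add_one hr]
    have hcard : ((N ^ d : ℕ) : ℕ∞) ≤ growthCount ((fun x => t • x + -(t • u)) '' U) r := by
      have h1 : (Set.univ : Set (Fin d → Fin N)).encard = ((N ^ d : ℕ) : ℕ∞) := by
        simp [Set.encard_univ]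
      rw [← h1, growthCount]
      refine Set.encard_le_encard_of_injOn
        (f := fun k : Fin d → Fin N => t • g (fun i => k i) + -(t • u)) ?_ ?_
      · intro k _
        refine ⟨⟨_, hgU _, rfl⟩, ?_⟩
        beta_reduce
        rw [mem_closedBall_zero_iff, ← sub_eq_add_neg, ← smul_sub, norm_smul, Real.norm_eq_abs,
          abs_of_pos ht]
        have h2 := norm_sub_le_of_mem_gridCube hs (hgk fun i => k i) (fun i => (k i).2)
        calc t * _ ≤ t * (√d * (s * (2 * r))) := by gcongr; exact h2.trans (by gcongr)
          _ = r := by simp only [t]; field_simp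
      · intro k _ l _ hkl
        have h3 : g (fun i => k i) = g (fun i => l i) :=
          smul_right_injective _ ht.ne' (add_right_cancel hkl)
        have h4 := eq_of_mem_gridCube hs (hgk fun i => k i) (h3 ▸ hgk fun i => l i)
        ext i
        exact congrFun h4 i
    calc ENNReal.ofReal (r ^ d) ≤ ENNReal.ofReal ((N : ℝ) ^ d) := by
          gcongr
          exact Nat.le_ceil r
      _ = (((N ^ d : ℕ) : ℕ∞) : ENNReal) := by
          rw [← Nat.cast_pow, ENNReal.ofReal_natCast]; simp
      _ ≤ _ := ENat.toENNReal_le.2 hcard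

/-! ### Counting grid points in a ball -/

/-- The points of absolute value at most `r` in `2 ^ e (ℤ ∖ {0})`. -/
noncomputable def boundedDyadic (r : ℝ) (e : ℤ) : Finset ℝ :=
  ((Finset.Icc (-⌊r / 2 ^ e⌋) ⌊r / 2 ^ e⌋).erase 0).image fun m : ℤ => 2 ^ e * (m : ℝ)

lemma card_boundedDyadic_le {r : ℝ} (hr : 0 ≤ r) (e : ℤ) :
    ((boundedDyadic r e).card : ℝ) ≤ 2 * r / 2 ^ e := by
  have h0 : 0 ≤ ⌊r / 2 ^ e⌋ := Int.floor_nonneg.2 (by positivity)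
  have h1 : (((boundedDyadic r e).card : ℤ) : ℝ) ≤ ((2 * ⌊r / 2 ^ e⌋ : ℤ) : ℝ) := by
    have h := (Finset.card_image_le (s := (Finset.Icc (-⌊r / 2 ^ e⌋) ⌊r / 2 ^ e⌋).erase 0)
      (f := fun m : ℤ => 2 ^ e * (m : ℝ)))
    rw [Finset.card_erase_of_mem (by simpa using h0), Int.card_Icc] at h
    rw [boundedDyadic]
    exact_mod_cast (by omega)
  have h2 := Int.floor_le (r / 2 ^ e)
  push_cast at h1
  rw [mul_div_assoc]
  linarith

lemma mem_boundedDyadic {r : ℝ} {e m : ℤ} (hm : m ≠ 0) (h : |2 ^ e * (m : ℝ)| ≤ r) :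
    2 ^ e * (m : ℝ) ∈ boundedDyadic r e := by
  have hpos : (0 : ℝ) < 2 ^ e := by positivity
  rw [abs_mul, abs_of_pos hpos, mul_comm, ← le_div_iff₀ hpos, ← Int.cast_abs, ← Int.le_floor,
    abs_le] at h
  exact Finset.mem_image_of_mem _ (Finset.mem_erase.2 ⟨hm, Finset.mem_Icc.2 h⟩)

lemma exponent_le_log {r : ℝ} (hr : 0 < r) {e m : ℤ} (hm : m ≠ 0)
    (h : |2 ^ e * (m : ℝ)| ≤ r) : e ≤ Int.log 2 r := by
  have hpos : (0 : ℝ) < 2 ^ e := by positivity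
  refine (Int.zpow_le_iff_le_log one_lt_two hr).1 (le_trans ?_ h)
  rw [abs_mul, abs_of_pos hpos, ← Int.cast_abs]
  have : (1 : ℝ) ≤ (|m| : ℤ) := by exact_mod_cast Int.one_le_abs hm
  push_cast at this ⊢
  exact le_mul_of_one_le_right hpos.le this

lemma neg_mul_le_of_sum_nonneg {n : ℕ} {e : Fin (n + 1) → ℤ} {K : ℤ} (hK : ∀ i, e i ≤ K)
    (hs : 0 ≤ ∑ i, e i) (i : Fin (n + 1)) : -(n * K) ≤ e i := by
  rw [Fin.sum_univ_succAbove e i] at hs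
  have h := Finset.sum_le_card_nsmul Finset.univ (fun j => e (i.succAbove j)) K fun j _ => hK _
  simp only [Finset.card_univ, Fintype.card_fin, nsmul_eq_mul] at h
  linarith

/-- A finite set containing the points of `dyadicGrids (n + 1) k` in `[-r, r] ^ (n + 1)`. -/
noncomputable def boundedDyadicGrids (n k : ℕ) (r : ℝ) : Finset (Fin (n + 1) → ℝ) :=
  (Fintype.piFinset fun _ : Fin n => Finset.Icc (-(n * Int.log 2 r)) (Int.log 2 r)).biUnion
    fun e => Fintype.piFinset fun i =>
      boundedDyadic r ((Fin.cons (k - ∑ j, e j) e : Fin (n + 1) → ℤ) i)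

lemma mem_boundedDyadicGrids {n k : ℕ} {r : ℝ} (hr : 0 < r) {x : Fin (n + 1) → ℝ}
    (hx : x ∈ dyadicGrids (n + 1) k) (hxr : ∀ i, |x i| ≤ r) : x ∈ boundedDyadicGrids n k r := by
  obtain ⟨e, m, hs, hem⟩ := hx
  have habs : ∀ i, |2 ^ e i * (m i : ℝ)| ≤ r := fun i => (hem i).2 ▸ hxr i
  have hle : ∀ i, e i ≤ Int.log 2 r := fun i => exponent_le_log hr (hem i).1 (habs i)
  have hge := neg_mul_le_of_sum_nonneg hle (by rw [hs]; positivity)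
  have he : (Fin.cons (k - ∑ j, Fin.tail e j) (Fin.tail e) : Fin (n + 1) → ℤ) = e := by
    rw [← hs, Fin.sum_univ_succ]
    simp [Fin.tail]
  refine Finset.mem_biUnion.2 ⟨Fin.tail e, ?_, ?_⟩
  · exact Fintype.mem_piFinset.2 fun i => Finset.mem_Icc.2 ⟨hge _, hle _⟩
  · rw [he]
    refine Fintype.mem_piFinset.2 fun i => ?_
    rw [(hem i).2]
    exact mem_boundedDyadic (hem i).1 (habs i)

/-- The first exponent is determined by the other `n`, each with `(n + 1) * Int.log 2 r + 1`
choices. The grid spacings multiply to `2 ^ k` whatever these are. -/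
lemma card_boundedDyadicGrids_le (n k : ℕ) {r : ℝ} (hr : 1 ≤ r) :
    ((boundedDyadicGrids n k r).card : ℝ) ≤
      ((n + 1) * Int.log 2 r + 1) ^ n * ((2 * r) ^ (n + 1) / 2 ^ k) := by
  have hK : 0 ≤ Int.log 2 r := (Int.zpow_le_iff_le_log one_lt_two (by linarith)).1 (by simpa)
  have hgrid : ∀ e : Fin n → ℤ, ((Fintype.piFinset fun i =>
      boundedDyadic r ((Fin.cons (k - ∑ j, e j) e : Fin (n + 1) → ℤ) i)).card : ℝ) ≤
      (2 * r) ^ (n + 1) / 2 ^ k := by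
    intro e
    rw [Fintype.card_piFinset, Nat.cast_prod]
    refine (Finset.prod_le_prod (fun _ _ => Nat.cast_nonneg _)
      fun i _ => card_boundedDyadic_le (by linarith) _).trans_eq ?_
    rw [Finset.prod_div_distrib, Finset.prod_const, Finset.card_univ, Fintype.card_fin]
    congr 1
    rw [Fin.prod_univ_succ]
    simp only [Fin.cons_zero, Fin.cons_succ]
    have : ∏ i, (2 : ℝ) ^ e i = 2 ^ ∑ i, e i := by
      induction (Finset.univ : Finset (Fin n)) using Finset.cons_induction with
      | empty => simp
      | cons a s ha ih => rw [Finset.prod_cons, Finset.sum_cons, ih, zpow_add₀ (by norm_num)]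
    rw [this, ← zpow_add₀ (by norm_num), sub_add_cancel, zpow_natCast]
  calc ((boundedDyadicGrids n k r).card : ℝ) ≤ _ := Nat.cast_le.2 Finset.card_biUnion_le
    _ = _ := Nat.cast_sum _ _
    _ ≤ _ := Finset.sum_le_card_nsmul _ _ _ fun e _ => hgrid e
    _ = _ := by
      rw [nsmul_eq_mul, Fintype.card_piFinset, Finset.prod_const, Finset.card_univ,
        Fintype.card_fin, Int.card_Icc]
      congr 1
      rw [Nat.cast_pow, ← Int.cast_natCast (R := ℝ), Int.toNat_of_nonneg
        (by linarith [mul_nonneg (Nat.cast_nonneg (α := ℤ) n) hK])]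
      push_cast
      ring

lemma Int.log_two_le_two_mul_log {r : ℝ} (hr : 1 ≤ r) : (Int.log 2 r : ℝ) ≤ 2 * Real.log r := by
  have h := Real.log_le_log (by positivity) (Int.zpow_log_le_self one_lt_two (by linarith : 0 < r))
  rw [Real.log_zpow] at h
  have hK : 0 ≤ Int.log 2 r := (Int.zpow_le_iff_le_log one_lt_two (by linarith)).1 (by simpa)
  have hK' : (0 : ℝ) ≤ Int.log 2 r := by exact_mod_cast hK
  have := Real.log_two_gt_d9
  push_cast at h
  nlinarith

lemma card_boundedDyadicGrids_le_log (n : ℕ) : ∃ k : ℕ, ∀ r : ℝ, 3 ≤ r →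
    ((boundedDyadicGrids n k r).card : ℝ) ≤ Real.log r ^ n * r ^ (n + 1) := by
  obtain ⟨k, hk⟩ := pow_unbounded_of_one_lt ((2 * n + 3 : ℝ) ^ n * 2 ^ (n + 1)) one_lt_two
  refine ⟨k, fun r hr => (card_boundedDyadicGrids_le n k (by linarith)).trans ?_⟩
  have hK : 0 ≤ Int.log 2 r := (Int.zpow_le_iff_le_log one_lt_two (by linarith)).1
    (by simp; linarith)
  have hK' : (0 : ℝ) ≤ Int.log 2 r := by exact_mod_cast hK
  -- `3 > exp 1`; this absorbs the additive 1 into the logarithm.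
  have hlog : 1 ≤ Real.log r := by
    rw [Real.le_log_iff_exp_le (by linarith)]
    linarith [Real.exp_one_lt_d9]
  have h1 : (n + 1) * (Int.log 2 r : ℝ) + 1 ≤ (2 * n + 3) * Real.log r := by
    have h2 := mul_le_mul_of_nonneg_left (Int.log_two_le_two_mul_log (by linarith : 1 ≤ r))
      (by positivity : (0 : ℝ) ≤ n + 1)
    linarith
  calc _ ≤ ((2 * n + 3) * Real.log r) ^ n * ((2 * r) ^ (n + 1) / 2 ^ k) := by gcongr
    _ = ((2 * n + 3 : ℝ) ^ n * 2 ^ (n + 1)) / 2 ^ k * (Real.log r ^ n * r ^ (n + 1)) := by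
      rw [mul_pow, mul_pow]; ring
    _ ≤ _ := mul_le_of_le_one_left (by positivity) ((div_le_one (by positivity)).2 hk.le)

/-! ### Transfer to Euclidean space and conclusion -/

lemma isUniversalConvexCovering_dyadicGrids (n k : ℕ) :
    IsUniversalConvexCovering
      (WithLp.ofLp ⁻¹' dyadicGrids (n + 1) k : Set (EuclideanSpace ℝ (Fin (n + 1)))) := by
  obtain ⟨v, hv, h⟩ := exists_dyadicGrids_inter_nonempty n
  refine ⟨v * 2 ^ (k : ℤ), by positivity, isVUniversalConvexCovering_iff.2 fun C hC hvC => ?_⟩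
  -- The frontier of a convex set is null, so the interior keeps the full volume.
  rw [← measure_interior_of_null_frontier (hC.addHaar_frontier _),
    ← (PiLp.volume_preserving_toLp (Fin (n + 1))).measure_preimage
      isOpen_interior.measurableSet.nullMeasurableSet] at hvC
  obtain ⟨x, hxC, hx⟩ := h _ (isOpen_interior.preimage (PiLp.continuous_toLp 2 _))
    (hC.interior.linear_preimage (WithLp.linearEquiv 2 ℝ (Fin (n + 1) → ℝ)).symm.toLinearMap) k hvC
  exact ⟨WithLp.toLp 2 x, interior_subset hxC, hx⟩

lemma exists_isUniversalConvexCovering_growthCount_le (n : ℕ) :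
    ∃ U : Set (EuclideanSpace ℝ (Fin (n + 1))), IsUniversalConvexCovering U ∧
      ∃ r₀ : ℝ, ∀ r : ℝ, r₀ ≤ r →
        (growthCount U r : ENNReal) ≤ ENNReal.ofReal (Real.log r ^ n * r ^ (n + 1)) := by
  obtain ⟨k, hk⟩ := card_boundedDyadicGrids_le_log n
  refine ⟨_, isUniversalConvexCovering_dyadicGrids n k, 3, fun r hr => ?_⟩
  have hcount : growthCount (WithLp.ofLp ⁻¹' dyadicGrids (n + 1) k :
      Set (EuclideanSpace ℝ (Fin (n + 1)))) r ≤ (boundedDyadicGrids n k r).card := by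
    rw [← Set.encard_coe_eq_coe_finsetCard]
    refine Set.encard_le_encard_of_injOn (f := WithLp.ofLp) (fun x hx => ?_)
      (WithLp.ofLp_injective 2).injOn
    exact mem_boundedDyadicGrids (by linarith) hx.1 fun i =>
      (PiLp.norm_apply_le x i).trans (mem_closedBall_zero_iff.1 hx.2)
  calc (growthCount _ r : ENNReal) ≤ (((boundedDyadicGrids n k r).card : ℕ∞) : ENNReal) :=
        ENat.toENNReal_le.2 hcount
    _ = ENNReal.ofReal ((boundedDyadicGrids n k r).card : ℝ) := by
        rw [ENNReal.ofReal_natCast]; simp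
    _ ≤ _ := ENNReal.ofReal_le_ofReal (hk r hr)

theorem theorem1 (d : ℕ) (hd : 1 ≤ d) :
    (∀ U : Set (EuclideanSpace ℝ (Fin d)), IsUniversalConvexCovering U →
      ∃ (t : ℝ) (w : EuclideanSpace ℝ (Fin d)), 0 < t ∧
        ∀ r : ℝ, 0 ≤ r →
          ENNReal.ofReal (r ^ d) ≤ (growthCount ((fun x => t • x + w) '' U) r : ENNReal)) ∧
    (∃ U : Set (EuclideanSpace ℝ (Fin d)), IsUniversalConvexCovering U ∧
      ∃ r₀ : ℝ, ∀ r : ℝ, r₀ ≤ r →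
        (growthCount U r : ENNReal) ≤ ENNReal.ofReal (Real.log r ^ (d - 1) * r ^ d)) := by
  refine ⟨fun U hU => hU.exists_growthCount_ge hd, ?_⟩
  obtain ⟨n, rfl⟩ := Nat.exists_eq_add_of_le' hd
  exact exists_isUniversalConvexCovering_growthCount_le n
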